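/- For $k\le\omega$ let $(\omega)^k$ be the set of partitions of $\omega$ into exactly $k$ nonempty blocks, each identified with the function $p:\omega\to k$ that sends $m$ to $i$ when $m$ lies in the $i$-th block, blocks being listed in the order of their least elements. For $p\in(\omega)^\omega$ let $(p)^2$ be the set of $q\in(\omega)^2$ such that every block of $p$ is contained in a block of $q$; $p$ is homogeneous for $S\subseteq(\omega)^2$ if $(p)^2\subseteq S$. For a finite string $\sigma$ that is an initial segment of some element of $(\omega)^2$ and in which both $0$ and $1$ appear, let $[\sigma]$ be the set of $p\in(\omega)^2$ that extend $\sigma$. Borel codes are labelled subtrees of $\omega^{<\omega}$. A Borel code for a $\Sigma^0_0$ or $\Pi^0_0$ set is a single root labelled by (a name for) one of the clopen sets $\emptyset$, $(\omega)^2$, $[\sigma]$, $(\omega)^2\setminus[\sigma]$, and represents that set. For finite $\alpha\ge 1$, a Borel code for a $\Sigma^0_\alpha$ (respectively $\Pi^0_\alpha$) set is a tree whose root is labelled $\cup$ (respectively $\cap$) and each of whose subtrees at level $1$ is a Borel code for a $\Sigma^0_\beta$ or a $\Pi^0_\beta$ set for some $\beta<\alpha$; it represents the union (respectively the intersection) of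 the sets represented by these subtrees. A code is computable if the tree together with its labelling is computable. Theorem. Let $n\in\omega$, and let $R\subseteq(\omega)^2$ be represented by a computable Borel code for a $\Sigma^0_{n+2}$ set. Then either there is a $\emptyset^{(n)}$-computable $x\in(\omega)^\omega$ that is homogeneous for $\overline{R}=(\omega)^2\setminus R$, or there is a $\emptyset^{(n+1)}$-computable $x\in(\omega)^\omega$ that is homogeneous for $R$. -/

import Mathlib

/-! ### Partitions of `ω` -/

namespace DualRamsey

/-- `p` is the canonical representation of a partition of `ω` into `k ≤ ω` nonempty blocks: it takes
values below `k`, it is ordered (every `j < p n` is already a value at some `m < n`), and it is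
surjective onto `k`. -/
def IsPartition (k : ℕ∞) (p : ℕ → ℕ) : Prop :=
  (∀ n, (p n : ℕ∞) < k) ∧ (∀ n, ∀ j < p n, ∃ m < n, p m = j) ∧
    ∀ i : ℕ, (i : ℕ∞) < k → ∃ n, p n = i

/-- The space `(ω)^k` of `k`-partitions of `ω`; `k = ⊤` gives the infinite partitions `(ω)^ω`. -/
abbrev Partition (k : ℕ∞) : Type := {p : ℕ → ℕ // IsPartition k p}

/-- The set `(p)^k` of `k`-coarsenings of the infinite partition `p`. -/
def coarsenings (p : Partition ⊤) (k : ℕ∞) : Set (Partition k) :=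
  {q | ∀ n m, p.1 n = p.1 m → q.1 n = q.1 m}

/-- `σ ∈ (ω)^k_fin`: the string `σ` is ordered, has entries below `k`, and every `i < k` appears. -/
def IsFinPartition (k : ℕ∞) (σ : List ℕ) : Prop :=
  (∀ a ∈ σ, (a : ℕ∞) < k) ∧ (∀ n (h : n < σ.length), ∀ j < σ[n], j ∈ σ.take n) ∧
    ∀ i : ℕ, (i : ℕ∞) < k → i ∈ σ

/-- The basic clopen set `[σ]` of all `p ∈ (ω)^k` that extend the string `σ`. -/
def cylinder (k : ℕ∞) (σ : List ℕ) : Set (Partition k) :=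
  {p | ∀ n (h : n < σ.length), p.1 n = σ[n]}

/-! ### Borel codes -/

/-- Labels of the nodes of a Borel code: `∪`, `∩`, and names of the clopen sets
`∅`, `(ω)^k`, `[σ]` and the complement of `[σ]`. -/
inductive Label : Type
  | union : Label
  | inter : Label
  | empty : Label
  | whole : Label
  | cyl (σ : List ℕ) : Label
  | compl (σ : List ℕ) : Label

/-- Labels as elements of a sum type; used only to say what computing a label means. -/
def Label.equivSum : Label ≃ (Bool ⊕ Bool) ⊕ (List ℕ ⊕ List ℕ) where
  toFun
    | .union => .inl (.inl true)
    | .inter => .inl (.inl false)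
    | .empty => .inl (.inr false)
    | .whole => .inl (.inr true)
    | .cyl σ => .inr (.inl σ)
    | .compl σ => .inr (.inr σ)
  invFun
    | .inl (.inl true) => .union
    | .inl (.inl false) => .inter
    | .inl (.inr false) => .empty
    | .inl (.inr true) => .whole
    | .inr (.inl σ) => .cyl σ
    | .inr (.inr σ) => .compl σ
  left_inv := by rintro (_ | _ | _ | _ | _ | _) <;> rfl
  right_inv := by rintro ((_ | _) | (_ | _)) <;> first | rfl | (rename_i b; cases b <;> rfl)

instance : Primcodable Label := Primcodable.ofEquiv _ Label.equivSum

/-- `Clopen k ℓ B`: the label `ℓ` names the clopen set `B ⊆ (ω)^k`. -/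
inductive Clopen (k : ℕ∞) : Label → Set (Partition k) → Prop
  | empty : Clopen k .empty ∅
  | whole : Clopen k .whole Set.univ
  | cyl (σ : List ℕ) (hσ : IsFinPartition k σ) : Clopen k (.cyl σ) (cylinder k σ)
  | compl (σ : List ℕ) (hσ : IsFinPartition k σ) : Clopen k (.compl σ) (cylinder k σ)ᶜ

/-- A labelled set of strings in `ω^{<ω}`: `T σ = none` says that `σ` is not a node, and
`T σ = some ℓ` that `σ` is a node with label `ℓ`. -/
abbrev LabelledTree : Type := List ℕ → Option Label

/-- The part of `T` above the level-one string `⟨a⟩`. -/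
def LabelledTree.subtree (T : LabelledTree) (a : ℕ) : LabelledTree := fun σ => T (a :: σ)

/-- The two kinds of classes in the Borel hierarchy. -/
inductive Kind : Type
  | sigma : Kind
  | pi : Kind

/-- `BorelCode k Γ α T A`: the labelled tree `T` is a Borel code for a (topologically) `Γ^0_α` set
in `(ω)^k` (where `Γ` is `Σ` or `Π`, and `α` is finite), and `A` is the set that `T` represents.
The subtrees at level one are those above the strings `⟨a⟩` that are nodes of `T`. -/
inductive BorelCode (k : ℕ∞) : Kind → ℕ → LabelledTree → Set (Partition k) → Prop
  | clopen (Γ : Kind) (T : LabelledTree) (ℓ : Label) (B : Set (Partition k))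
      (root : T [] = some ℓ) (clopen : Clopen k ℓ B) (leaf : ∀ σ, σ ≠ [] → T σ = none) :
      BorelCode k Γ 0 T B
  | union (α : ℕ) (pos : 1 ≤ α) (T : LabelledTree) (root : T [] = some .union)
      (tree : ∀ a, T [a] = none → ∀ σ, T (a :: σ) = none)
      (Γ : ℕ → Kind) (β : ℕ → ℕ) (A : ℕ → Set (Partition k))
      (lt : ∀ a, T [a] ≠ none → β a < α)
      (code : ∀ a, T [a] ≠ none → BorelCode k (Γ a) (β a) (T.subtree a) (A a)) :
      BorelCode k .sigma α T {p | ∃ a, T [a] ≠ none ∧ p ∈ A a}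
  | inter (α : ℕ) (pos : 1 ≤ α) (T : LabelledTree) (root : T [] = some .inter)
      (tree : ∀ a, T [a] = none → ∀ σ, T (a :: σ) = none)
      (Γ : ℕ → Kind) (β : ℕ → ℕ) (A : ℕ → Set (Partition k))
      (lt : ∀ a, T [a] ≠ none → β a < α)
      (code : ∀ a, T [a] ≠ none → BorelCode k (Γ a) (β a) (T.subtree a) (A a)) :
      BorelCode k .pi α T {p | ∀ a, T [a] ≠ none → p ∈ A a}

/-! ### Oracle machines and the Turing jump -/

/-- Programs for functions that are partial recursive relative to an oracle. The constructors are
those of the inductive definition of `Nat.RecursiveIn`. -/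
inductive Program : Type
  | zero : Program
  | succ : Program
  | left : Program
  | right : Program
  | oracle : Program
  | pair (c d : Program) : Program
  | comp (c d : Program) : Program
  | prec (c d : Program) : Program
  | rfind (c : Program) : Program

/-- The partial function that a program computes from the oracle `g`. -/
def Program.eval (g : ℕ →. ℕ) : Program → ℕ →. ℕ
  | .zero => fun _ => 0
  | .succ => Nat.succ
  | .left => fun n => (Nat.unpair n).1
  | .right => fun n => (Nat.unpair n).2
  | .oracle => g
  | .pair c d => fun n => Nat.pair <$> c.eval g n <*> d.eval g n
  | .comp c d => fun n => d.eval g n >>= c.eval g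
  | .prec c d => fun p =>
      let (a, n) := Nat.unpair p
      n.rec (c.eval g a) fun y IH => do
        let i ← IH
        d.eval g (Nat.pair a (Nat.pair y i))
  | .rfind c => fun a => Nat.rfind fun n => (fun m => m = 0) <$> c.eval g (Nat.pair a n)

/-- The Gödel number of a program; this is a bijection between programs and `ω`. -/
def Program.index : Program → ℕ
  | .zero => 0
  | .succ => 1
  | .left => 2
  | .right => 3
  | .oracle => 4
  | .pair c d => 4 * Nat.pair c.index d.index + 5
  | .comp c d => 4 * Nat.pair c.index d.index + 6
  | .prec c d => 4 * Nat.pair c.index d.index + 7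
  | .rfind c => 4 * c.index + 8

open Classical in
/-- The characteristic function of `X ⊆ ω`, as an oracle. -/
noncomputable def charFun (X : Set ℕ) : ℕ →. ℕ := fun n => Part.some (if n ∈ X then 1 else 0)

/-- The Turing jump `X' = {e : Φ_e^X(e)↓}`. -/
def jump (X : Set ℕ) : Set ℕ :=
  {e | ∃ c : Program, c.index = e ∧ (c.eval (charFun X) e).Dom}

/-- The `n`-th jump `∅^{(n)}` of the empty set. -/
def emptyJump (n : ℕ) : Set ℕ := jump^[n] ∅

/-- The partition `p` is computable from the oracle `X`. -/
def ComputableFrom {k : ℕ∞} (X : Set ℕ) (p : Partition k) : Prop :=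
  ComputableIn {charFun X} p.1

end DualRamsey

/-! ### Computability relative to a set of oracles -/

section Relative

open Encodable Part

variable {α β γ σ : Type*} [Primcodable α] [Primcodable β] [Primcodable γ] [Primcodable σ]
variable {O : Set (ℕ →. ℕ)}

/-! Force with finite 0-1 strings, read as initial segments of elements of $(\omega)^2$. A union
node is forced true when a child is, and false when no extension forces a child true; intersections
are dual. Decisions are dense, forced statements hold of every sufficiently generic `q`
(`BorelCode.mem_iff_of_forces`), and each level costs one jump (`decidableIn_forces`).

The combinatorics is in `exists_partition_forall_coarsening`. A partial partition with finitely many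
blocks has finitely many 2-colourings, and an extension of any one colouring lifts to an extension
of the partial partition, so all colourings can be made to meet finitely many dense sets. Opening a
new block creates one essentially new colouring, true on that block alone; starting it well requires
conditions $0^m1\tau$ with $m$ arbitrarily large.

Write $R$ as the union of the children of the root. If $0^m1\tau$ forces a child for arbitrarily
large $m$, then $\emptyset^{(n+1)}$ builds `x` all of whose 2-coarsenings force a child
(`exists_partition_forces`). Otherwise, past some $N$ no condition forces any child. Union children
are then refuted automatically, and an intersection child is refuted by meeting the dense set of
conditions that force one of its own children false. That is a question about level $n$, so
$\emptyset^{(n)}$ suffices (`exists_partition_forces_not`). -/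

theorem RecursiveIn.comp {f : β →. σ} {g : α → β} (hf : RecursiveIn O f) (hg : ComputableIn O g) :
    RecursiveIn O fun a => f (g a) :=
  (Nat.RecursiveIn.comp hf hg).of_eq fun n => by
    simp only [map_some, bind_eq_bind]
    rcases e : decode (α := α) n with - | a <;> simp [encodek]

theorem ComputableIn.comp {f : β → σ} {g : α → β} (hf : ComputableIn O f)
    (hg : ComputableIn O g) : ComputableIn O fun a => f (g a) :=
  RecursiveIn.comp (f := fun b => Part.some (f b)) hf hg

theorem ComputableIn.pair {f : α → β} {g : α → γ} (hf : ComputableIn O f)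
    (hg : ComputableIn O g) : ComputableIn O fun a => (f a, g a) :=
  (Nat.RecursiveIn.pair hf hg).of_eq fun n => by
    cases decode (α := α) n <;> simp [Seq.seq]

theorem Nat.RecursiveIn.prec' {f g h : ℕ →. ℕ} (hf : Nat.RecursiveIn O f)
    (hg : Nat.RecursiveIn O g) (hh : Nat.RecursiveIn O h) :
    Nat.RecursiveIn O fun a => (f a).bind fun n => n.rec (g a)
      fun y IH => do {let i ← IH; h (Nat.pair a (Nat.pair y i))} :=
  (Nat.RecursiveIn.comp (Nat.RecursiveIn.prec hg hh)
    (Nat.RecursiveIn.pair Nat.Partrec.some.recursiveIn hf)).of_eq fun a =>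
    ext fun s => by simp [Seq.seq]

theorem RecursiveIn.nat_rec {f : α → ℕ} {g : α →. σ} {h : α × (ℕ × σ) →. σ}
    (hf : ComputableIn O f) (hg : RecursiveIn O g) (hh : RecursiveIn O h) :
    RecursiveIn O fun a => (f a).rec (g a) fun y IH => IH.bind fun i => h (a, (y, i)) :=
  (Nat.RecursiveIn.prec' hf hg hh).of_eq fun n => by
    rcases e : decode (α := α) n with - | a
    · simp
    · simp only [coe_some, bind_some]
      induction f a <;> simp_all

theorem RecursiveIn.rfind {p : α × ℕ → Bool} (hp : ComputableIn O p) :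
    RecursiveIn O fun a => Nat.rfind fun n => Part.some (p (a, n)) :=
  (Nat.RecursiveIn.rfind <|
        -- The underlying search looks for a zero, so truth is coded by 0.
        ((Primrec.dom_bool fun b => cond b 0 1).computableIn (O := O)).comp hp).of_eq
    fun n => by
    rcases e : decode (α := α) n with - | a
    · simpa [e] using Nat.rfind_zero_none _ rfl
    · simp [e, map_id']
      congr 1; funext n; cases p (a, n) <;> simp

theorem ComputableIn.nat_rec {f : α → ℕ} {g : α → σ} {h : α × (ℕ × σ) → σ}
    (hf : ComputableIn O f) (hg : ComputableIn O g) (hh : ComputableIn O h) :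
    ComputableIn O fun a => ((f a).rec (g a) fun y i => h (a, (y, i)) : σ) :=
  (RecursiveIn.nat_rec hf hg hh).of_eq fun a => by
    beta_reduce
    induction f a with
    | zero => rfl
    | succ n ih => simp only [ih, bind_some]

/-- A predicate is decidable relative to the oracles `O`. -/
def DecidableIn (O : Set (ℕ →. ℕ)) (P : α → Prop) : Prop :=
  ∃ f : α → Bool, ComputableIn O f ∧ ∀ a, f a = true ↔ P a

namespace DecidableIn

variable {P Q : α → Prop}

theorem of_iff (hP : DecidableIn O P) (h : ∀ a, P a ↔ Q a) : DecidableIn O Q := by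
  obtain ⟨f, hf, e⟩ := hP
  exact ⟨f, hf, fun a => (e a).trans (h a)⟩

theorem comp {P : β → Prop} (hP : DecidableIn O P) {g : α → β} (hg : ComputableIn O g) :
    DecidableIn O fun a => P (g a) := by
  obtain ⟨f, hf, e⟩ := hP
  exact ⟨_, hf.comp hg, fun a => e (g a)⟩

theorem not (hP : DecidableIn O P) : DecidableIn O fun a => ¬ P a := by
  obtain ⟨f, hf, e⟩ := hP
  exact ⟨_, (Primrec.dom_bool Bool.not).computableIn.comp hf, fun a => by simp [← e a]⟩

theorem and (hP : DecidableIn O P) (hQ : DecidableIn O Q) : DecidableIn O fun a => P a ∧ Q a := by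
  obtain ⟨f, hf, e⟩ := hP
  obtain ⟨g, hg, e'⟩ := hQ
  exact ⟨_, (Primrec.dom_bool₂ Bool.and).computableIn₂.comp (hf.pair hg),
    fun a => by simp [← e a, ← e' a]⟩

theorem or (hP : DecidableIn O P) (hQ : DecidableIn O Q) : DecidableIn O fun a => P a ∨ Q a :=
  (hP.not.and hQ.not).not.of_iff fun a => by tauto

theorem imp (hP : DecidableIn O P) (hQ : DecidableIn O Q) : DecidableIn O fun a => P a → Q a :=
  (hP.not.or hQ).of_iff fun a => by tauto

theorem of_primrecPred (hP : PrimrecPred P) : DecidableIn O P := by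
  obtain ⟨_, h⟩ := hP
  exact ⟨_, h.computableIn, fun a => by simp⟩

/-- Decidability is closed under bounded universal quantification. -/
theorem forall_lt {P : α × ℕ → Prop} (hP : DecidableIn O P) {b : α → ℕ} (hb : ComputableIn O b) :
    DecidableIn O fun a => ∀ i < b a, P (a, i) := by
  obtain ⟨f, hf, e⟩ := hP
  refine ⟨fun a => (b a).rec true fun i r => r && f (a, i),
    ComputableIn.nat_rec (h := fun x => x.2.2 && f (x.1, x.2.1)) hb (.const true) ?_, fun a => ?_⟩
  · exact (Primrec.dom_bool₂ Bool.and).computableIn₂.comp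
      ((ComputableIn.snd.comp ComputableIn.snd).pair
        (hf.comp (ComputableIn.fst.pair (ComputableIn.fst.comp ComputableIn.snd))))
  · beta_reduce
    induction b a with
    | zero => simp
    | succ n ih => rw [Nat.forall_lt_succ_right]; simp [ih, e]

/-- Decidability is closed under bounded existential quantification. -/
theorem exists_lt {P : α × ℕ → Prop} (hP : DecidableIn O P) {b : α → ℕ} (hb : ComputableIn O b) :
    DecidableIn O fun a => ∃ i < b a, P (a, i) :=
  (hP.not.forall_lt hb).not.of_iff fun a => by push Not; rfl

end DecidableIn

/-- Iterated search: if every state satisfying the invariant `I` has an admissible successor and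
admissible successors preserve `I`, some sequence of admissible states is computable. -/
theorem exists_computableIn_seq {Q : (ℕ × ℕ) × ℕ → Prop} (hQ : DecidableIn O Q) (I : ℕ → ℕ → Prop)
    {y₀ : ℕ} (h₀ : I 0 y₀) (hex : ∀ k y, I k y → ∃ w, Q ((k, y), w))
    (hpres : ∀ k y w, I k y → Q ((k, y), w) → I (k + 1) w) :
    ∃ f : ℕ → ℕ, ComputableIn O f ∧ f 0 = y₀ ∧ ∀ k, I k (f k) ∧ Q ((k, f k), f (k + 1)) := by
  classical
  obtain ⟨p, hp, e⟩ := hQ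
  have hs : ∀ k y, I k y → ∃ w, p ((k, y), w) = true ∧
      w ∈ Nat.rfind fun n => Part.some (p ((k, y), n)) := by
    intro k y hy
    obtain ⟨w, hw⟩ := hex k y hy
    obtain ⟨n, hn, -⟩ := Nat.rfind_min' (p := fun n => p ((k, y), n)) ((e _).2 hw)
    exact ⟨n, by simpa using (Nat.rfind_spec hn), hn⟩
  choose! s hsp hsm using hs
  let f : ℕ → ℕ := fun k => k.rec y₀ s
  have hI : ∀ k, I k (f k) := by
    intro k
    induction k with
    | zero => exact h₀
    | succ k ih => exact hpres k _ _ ih ((e _).1 (hsp _ _ ih))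
  refine ⟨f, ?_, rfl, fun k => ⟨hI k, (e _).1 (hsp _ _ (hI k))⟩⟩
  -- `s` is arbitrary off the invariant and need not be computable. The recursion is therefore run
  -- with the partial search, which converges along the states `f k`.
  have := RecursiveIn.nat_rec (O := O) (f := fun n : ℕ => n) (g := fun _ => Part.some y₀)
    (h := fun x : ℕ × (ℕ × ℕ) => Nat.rfind fun n => Part.some (p ((x.2.1, x.2.2), n)))
    ComputableIn.id (ComputableIn.const y₀)
    ((RecursiveIn.rfind hp).comp (ComputableIn.snd (α := ℕ) (β := ℕ × ℕ)))
  refine this.of_eq_tot fun k => ?_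
  induction k with
  | zero => exact Part.mem_some _
  | succ k ih => exact Part.mem_bind_iff.2 ⟨_, ih, hsm _ _ (hI k)⟩

end Relative

/-! ### The Turing jump -/

namespace DualRamsey

open Encodable

theorem Program.exists_eval_eq {g f : ℕ →. ℕ} (hf : Nat.RecursiveIn {g} f) :
    ∃ c : Program, c.eval g = f := by
  induction hf with
  | zero => exact ⟨.zero, rfl⟩
  | succ => exact ⟨.succ, rfl⟩
  | left => exact ⟨.left, rfl⟩
  | right => exact ⟨.right, rfl⟩
  | oracle h hh => exact ⟨.oracle, hh.symm⟩
  | pair _ _ ih₁ ih₂ =>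
    obtain ⟨c, rfl⟩ := ih₁; obtain ⟨d, rfl⟩ := ih₂; exact ⟨.pair c d, rfl⟩
  | comp _ _ ih₁ ih₂ =>
    obtain ⟨c, rfl⟩ := ih₁; obtain ⟨d, rfl⟩ := ih₂; exact ⟨.comp c d, rfl⟩
  | prec _ _ ih₁ ih₂ =>
    obtain ⟨c, rfl⟩ := ih₁; obtain ⟨d, rfl⟩ := ih₂; exact ⟨.prec c d, rfl⟩
  | rfind _ ih => obtain ⟨c, rfl⟩ := ih; exact ⟨.rfind c, rfl⟩

/-- The atoms take the values below 5; from 5 on, the residue modulo 4 identifies the constructor.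
-/
theorem Program.index_injective : Function.Injective Program.index := by
  intro c
  induction c with
  | pair c₁ c₂ h₁ h₂ | comp c₁ c₂ h₁ h₂ | prec c₁ c₂ h₁ h₂ =>
    intro d h
    cases d with
    | pair d₁ d₂ | comp d₁ d₂ | prec d₁ d₂ =>
      simp only [Program.index] at h
      first
        | omega
        | obtain ⟨e₁, e₂⟩ := Nat.pair_eq_pair.1
            (show Nat.pair c₁.index c₂.index = Nat.pair d₁.index d₂.index by omega)
          rw [h₁ e₁, h₂ e₂]
    | _ => simp only [Program.index] at h; omega
  | rfind c hc =>
    intro d h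
    cases d with
    | rfind d => simp only [Program.index] at h; rw [hc (show c.index = d.index by omega)]
    | _ => simp only [Program.index] at h; omega
  | _ => intro d h; cases d <;> simp only [Program.index] at h <;> first | rfl | omega

/-- The program with constant value `n`. -/
def Program.const : ℕ → Program
  | 0 => .zero
  | n + 1 => .comp .succ (Program.const n)

theorem Program.eval_const (g : ℕ →. ℕ) (n m : ℕ) :
    (Program.const n).eval g m = Part.some n := by
  induction n with
  | zero => rfl
  | succ n ih =>
    change (Program.const n).eval g m >>= Program.succ.eval g = _
    rw [ih]
    exact Part.bind_some _ _

theorem Program.primrec_index_const : Primrec fun n => (Program.const n).index := by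
  have h : Primrec fun n : ℕ => (n.rec 0 fun _ r => 4 * Nat.pair 1 r + 6 : ℕ) :=
    Primrec.nat_rec₁ (f := fun _ r => 4 * Nat.pair 1 r + 6) 0
      (Primrec.nat_add.comp (Primrec.nat_mul.comp (Primrec.const 4)
        (Primrec₂.natPair.comp (Primrec.const 1) Primrec.snd)) (Primrec.const 6))
  refine h.of_eq fun n => ?_
  induction n with
  | zero => rfl
  | succ n ih => simp only [ih, Program.const, Program.index]

theorem mem_jump_index {X : Set ℕ} {c : Program} :
    c.index ∈ jump X ↔ (c.eval (charFun X) c.index).Dom := by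
  refine ⟨?_, fun h => ⟨c, rfl, h⟩⟩
  rintro ⟨d, hd, h⟩
  rwa [Program.index_injective hd] at h

theorem decidableIn_charFun (X : Set ℕ) : DecidableIn {charFun X} fun n => n ∈ X := by
  classical
  have h : ComputableIn {charFun X} fun n => if n ∈ X then 1 else 0 := by
    have := RecursiveIn.oracle (charFun X) (Set.mem_singleton _)
    exact this.of_eq fun n => by unfold charFun; congr
  refine ⟨fun n => decide ((if n ∈ X then 1 else 0) = 1), ?_,
    fun n => by by_cases h : n ∈ X <;> simp [h]⟩
  exact (Primrec.eq.comp Primrec.id (Primrec.const 1)).decide.computableIn.comp h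

variable {α β : Type*} [Primcodable α] [Primcodable β]

/-- The jump decides existential quantification over decidable predicates. -/
theorem _root_.DecidableIn.exists_jump [Inhabited β] {X : Set ℕ} {P : α × β → Prop}
    (hP : DecidableIn {charFun X} P) :
    DecidableIn {charFun (jump X)} fun a => ∃ b, P (a, b) := by
  -- Numbers that code nothing are read as `default`, so a successful search always yields a genuine
  -- witness.
  have hdec : ComputableIn {charFun X} fun x : α × ℕ => (x.1, (decode (α := β) x.2).getD default) :=
    (Primrec.pair Primrec.fst (Primrec.option_getD.comp (Primrec.decode.comp Primrec.snd)
      (Primrec.const default))).computableIn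
  obtain ⟨f, hf, e⟩ := hP.comp hdec
  obtain ⟨c, hc⟩ := Program.exists_eval_eq (RecursiveIn.rfind hf)
  -- This program ignores its input and searches for a witness for `a`, so it halts on its own index
  -- exactly when one exists.
  have hi : Primrec fun a : α => (Program.comp c (Program.const (encode a))).index :=
    Primrec.nat_add.comp (Primrec.nat_mul.comp (Primrec.const 4)
        (Primrec₂.natPair.comp (Primrec.const c.index)
          (Program.primrec_index_const.comp Primrec.encode))) (Primrec.const 6)
  refine ((decidableIn_charFun (jump X)).comp hi.computableIn).of_iff fun a => ?_
  rw [mem_jump_index]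
  have : (Program.comp c (Program.const (encode a))).eval (charFun X)
      (Program.comp c (Program.const (encode a))).index = c.eval (charFun X) (encode a) := by
    change (Program.const (encode a)).eval (charFun X) _ >>= c.eval (charFun X) = _
    rw [Program.eval_const]
    exact Part.bind_some _ _
  rw [this, hc]
  simp only [encodek, Part.coe_some, Part.bind_some, Part.map_Dom]
  refine Nat.rfind_dom.trans ?_
  constructor
  · rintro ⟨n, hn⟩
    exact ⟨_, (e (a, n)).1 (Part.mem_some_iff.1 hn.1).symm⟩
  · rintro ⟨b, hb⟩
    exact ⟨encode b, Part.mem_some_iff.2 ((e (a, encode b)).2 (by simpa using hb)).symm,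
      fun _ => trivial⟩

theorem _root_.DecidableIn.jump {X : Set ℕ} {P : α → Prop} (hP : DecidableIn {charFun X} P) :
    DecidableIn {charFun (jump X)} P :=
  (DecidableIn.exists_jump (β := ℕ) (P := fun x => P x.1) (hP.comp ComputableIn.fst)).of_iff
    fun a => by simp

theorem emptyJump_succ (n : ℕ) : emptyJump (n + 1) = jump (emptyJump n) :=
  Function.iterate_succ_apply' _ _ _

end DualRamsey

/-! ### Partitions all of whose coarsenings meet given sets of strings -/

namespace DualRamsey

/-- The initial segment of length `l` of `q`, where `true` marks the elements of block `1`. -/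
def initSeg (q : ℕ → ℕ) (l : ℕ) : List Bool := (List.range l).map fun i => decide (q i = 1)

theorem initSeg_length (q : ℕ → ℕ) (l : ℕ) : (initSeg q l).length = l := by simp [initSeg]

theorem initSeg_add (q : ℕ → ℕ) (l k : ℕ) : ∃ τ, initSeg q (l + k) = initSeg q l ++ τ := by
  simp [initSeg, List.range_add]

theorem initSeg_of_le (q : ℕ → ℕ) {l m : ℕ} (h : l ≤ m) : ∃ τ, initSeg q m = initSeg q l ++ τ := by
  obtain ⟨k, rfl⟩ := Nat.exists_eq_add_of_le h
  exact initSeg_add q l k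

/-- A number codes a colouring of blocks, bit `j` being the colour of block `j`; quantifying over
colourings thus becomes bounded. -/
theorem primrec_testBit : Primrec₂ Nat.testBit := by
  have hpow : Primrec₂ ((· ^ ·) : ℕ → ℕ → ℕ) := Primrec₂.unpaired'.1 Nat.Primrec.pow
  have h : Primrec fun x : ℕ × ℕ => decide (x.1 / 2 ^ x.2 % 2 = 1) :=
    (Primrec.eq.comp (Primrec.nat_mod.comp (Primrec.nat_div.comp Primrec.fst
      (hpow.comp (Primrec.const 2) Primrec.snd)) (Primrec.const 2)) (Primrec.const 1)).decide
  exact h.of_eq fun x => (Nat.testBit_eq_decide_div_mod_eq).symm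

/-! ### Construction of a partition by finite stages -/

section Construction

variable (D : ℕ → List Bool → Prop)

/-- The string `w` properly continues the partial partition `u` with blocks `0, …, k`: it adds the
block `k + 1`, and under every colouring of the blocks it meets the first `k + 1` requirements. -/
def Continues (k : ℕ) (u w : List ℕ) : Prop :=
  w.take u.length = u ∧ (∀ a ∈ w, a ≤ k + 1) ∧ (∃ a ∈ w, a = k + 1) ∧
    ∀ c < 2 ^ (k + 2), (c % 2 = 0 ∧ c ≠ 0) → ∀ s < k + 1, D s (w.map c.testBit)

/-- The string `u` is a partial partition with blocks `0, …, k`, and all its colourings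
meet `D 0`. -/
structure IsStage (k : ℕ) (u : List ℕ) : Prop where
  le : ∀ a ∈ u, a ≤ k
  mem : ∀ j ≤ k, j ∈ u
  ordered : ∀ i (h : i < u.length), ∀ j < u[i], j ∈ u.take i
  length : k < u.length
  color : ∀ c : ℕ → Bool, c 0 = false → (∃ j ≤ k, c j = true) → D 0 (u.map c)

variable {D} {O : Set (ℕ →. ℕ)}

theorem decidableIn_continues (hD : DecidableIn O fun x : ℕ × List Bool => D x.1 x.2) :
    DecidableIn O fun x : (ℕ × List ℕ) × List ℕ => Continues D x.1.1 x.1.2 x.2 := by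
  have hpow : Primrec₂ ((· ^ ·) : ℕ → ℕ → ℕ) := Primrec₂.unpaired'.1 Nat.Primrec.pow
  have hk : Primrec fun x : (ℕ × List ℕ) × List ℕ => x.1.1 + 1 :=
    Primrec.succ.comp (Primrec.fst.comp Primrec.fst)
  have h₁ : PrimrecPred fun x : (ℕ × List ℕ) × List ℕ => x.2.take x.1.2.length = x.1.2 :=
    Primrec.eq.comp (Primrec.list_take.comp (Primrec.list_length.comp
      (Primrec.snd.comp Primrec.fst)) Primrec.snd) (Primrec.snd.comp Primrec.fst)
  have h₂ : PrimrecPred fun x : (ℕ × List ℕ) × List ℕ => ∀ a ∈ x.2, a ≤ x.1.1 + 1 :=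
    (PrimrecRel.forall_mem_list Primrec.nat_le).comp Primrec.snd hk
  have h₃ : PrimrecPred fun x : (ℕ × List ℕ) × List ℕ => ∃ a ∈ x.2, a = x.1.1 + 1 :=
    (PrimrecRel.exists_mem_list Primrec.eq).comp Primrec.snd hk
  have h₄ : PrimrecPred fun x : ((ℕ × List ℕ) × List ℕ) × ℕ => x.2 % 2 = 0 :=
    Primrec.eq.comp (Primrec.nat_mod.comp Primrec.snd (Primrec.const 2)) (Primrec.const 0)
  have h₅ : PrimrecPred fun x : ((ℕ × List ℕ) × List ℕ) × ℕ => x.2 ≠ 0 :=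
    (Primrec.eq.comp Primrec.snd (Primrec.const 0)).not
  have h₆ : Primrec fun x : (((ℕ × List ℕ) × List ℕ) × ℕ) × ℕ =>
      (x.2, x.1.1.2.map x.1.2.testBit) :=
    Primrec.pair Primrec.snd (Primrec.list_map (Primrec.snd.comp (Primrec.fst.comp Primrec.fst))
      (primrec_testBit.comp (Primrec.snd.comp (Primrec.fst.comp Primrec.fst)) Primrec.snd))
  have h₇ : DecidableIn O fun x : ((ℕ × List ℕ) × List ℕ) × ℕ =>
      ∀ s < x.1.1.1 + 1, D s (x.1.2.map x.2.testBit) :=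
    (hD.comp h₆.computableIn).forall_lt (hk.comp Primrec.fst).computableIn
  exact (DecidableIn.of_primrecPred h₁).and <| (DecidableIn.of_primrecPred h₂).and <|
    (DecidableIn.of_primrecPred h₃).and <|
    (((DecidableIn.of_primrecPred h₄).and (.of_primrecPred h₅)).imp h₇).forall_lt
      (hpow.comp (Primrec.const 2) (Primrec.succ.comp hk)).computableIn

/-- The pairs (colouring, requirement) are treated one at a time, and `mono` preserves what has been
met. Codes are even because block 0 contains the number 0, which every coarsening puts in its block
0. -/
theorem exists_append_forall
    (mono : ∀ s σ τ, D s σ → D s (σ ++ τ))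
    (dense : ∀ σ, D 0 σ → ∀ s, ∃ τ, D s (σ ++ τ))
    {K : ℕ} {u : List ℕ}
    (hu : ∀ c : ℕ → Bool, c 0 = false → (∃ j ≤ K, c j = true) → D 0 (u.map c))
    (L : List (ℕ × ℕ)) :
    ∃ v : List ℕ, (∀ a ∈ v, a ≤ K) ∧ ∀ x ∈ L, x.1 < 2 ^ (K + 1) → (x.1 % 2 = 0 ∧ x.1 ≠ 0) →
      D x.2 ((u ++ v).map x.1.testBit) := by
  induction L with
  | nil => exact ⟨[], by simp, by simp⟩
  | cons x L ih =>
    obtain ⟨v, hv, hL⟩ := ih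
    by_cases hx : x.1 < 2 ^ (K + 1) ∧ (x.1 % 2 = 0 ∧ x.1 ≠ 0)
    · obtain ⟨hlt, heven, hne⟩ := hx
      obtain ⟨j, hj⟩ := Nat.exists_testBit_of_ne_zero hne
      have hjK : j ≤ K := by
        by_contra hc
        have : x.1 < 2 ^ j := hlt.trans_le (Nat.pow_le_pow_right (by norm_num) (by omega))
        rw [Nat.testBit_lt_two_pow this] at hj
        exact absurd hj (by simp)
      have h0 : x.1.testBit 0 = false := by simp [Nat.testBit_zero, heven]
      obtain ⟨τ, hτ⟩ := dense _ (mono _ _ (v.map x.1.testBit) (hu _ h0 ⟨j, hjK, hj⟩)) x.2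
      -- Spelling `τ` with block `j` for `true` and block 0 for `false` makes this colouring read it
      -- back unchanged.
      have hm : (τ.map fun b => cond b j 0).map x.1.testBit = τ := by
        rw [List.map_map]
        conv_rhs => rw [← List.map_id τ]
        refine List.map_congr_left fun b _ => ?_
        cases b <;> simp [hj, h0]
      refine ⟨v ++ τ.map fun b => cond b j 0, ?_, ?_⟩
      · intro a ha
        rcases List.mem_append.1 ha with ha | ha
        · exact hv a ha
        · obtain ⟨b, -, rfl⟩ := List.mem_map.1 ha
          cases b <;> simp [hjK]
      · intro y hy hylt hye
        rcases List.mem_cons.1 hy with rfl | hy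
        · simpa only [List.map_append, hm, List.append_assoc] using hτ
        · rw [← List.append_assoc, List.map_append]
          exact mono _ _ _ (hL y hy hylt hye)
    · refine ⟨v, hv, fun y hy hylt hye => ?_⟩
      rcases List.mem_cons.1 hy with rfl | hy
      · exact absurd ⟨hylt, hye⟩ hx
      · exact hL y hy hylt hye

theorem IsStage.exists_continues {k : ℕ} {u : List ℕ} (h : IsStage D k u)
    (mono : ∀ s σ τ, D s σ → D s (σ ++ τ))
    (cofinal : ∀ N, ∃ m ≥ N, ∃ τ, D 0 (List.replicate m false ++ true :: τ))
    (dense : ∀ σ, D 0 σ → ∀ s, ∃ τ, D s (σ ++ τ)) :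
    ∃ w, Continues D k u w := by
  -- The colouring that is true only on the new block reads `u` as all `false`. Hence the condition
  -- must start with at least `u.length` zeros; `t` spells the rest of it.
  obtain ⟨m, hm, τ, hτ⟩ := cofinal u.length
  obtain ⟨t, ht⟩ : ∃ t, t = List.replicate (m - u.length) 0 ++ (k + 1) ::
    τ.map fun b => cond b (k + 1) 0 := ⟨_, rfl⟩
  have hcolor : ∀ c : ℕ → Bool, c 0 = false → (∃ j ≤ k + 1, c j = true) →
      D 0 ((u ++ t).map c) := by
    intro c hc hj
    rw [List.map_append]
    -- A colouring that is true on an old block already meets `D 0` on `u`.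
    by_cases hk : ∃ j ≤ k, c j = true
    · exact mono _ _ _ (h.color c hc hk)
    · push Not at hk
      obtain ⟨j, hj, hcj⟩ := hj
      have hjk : j = k + 1 := by
        by_contra hne
        exact hk j (by omega) hcj
      subst hjk
      convert hτ using 1
      have hu : u.map c = List.replicate u.length false :=
        List.eq_replicate_iff.2 ⟨by simp, fun b hb => by
          obtain ⟨a, ha, rfl⟩ := List.mem_map.1 hb
          simpa using hk a (h.le a ha)⟩
      have hm' : (τ.map fun b => cond b (k + 1) 0).map c = τ := by
        rw [List.map_map]
        conv_rhs => rw [← List.map_id τ]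
        refine List.map_congr_left fun b _ => ?_
        cases b <;> simp [hcj, hc]
      rw [ht, List.map_append, List.map_cons, hm', hu, List.map_replicate, hc, hcj,
        ← List.append_assoc, List.replicate_append_replicate, Nat.add_sub_cancel' hm]
  obtain ⟨v, hv, hL⟩ := exists_append_forall mono dense hcolor
    ((List.range (2 ^ (k + 2))).product (List.range (k + 1)))
  refine ⟨u ++ t ++ v, by simp, ?_, ⟨k + 1, by simp [ht], rfl⟩, ?_⟩
  · intro a ha
    simp only [ht, List.mem_append, List.mem_cons, List.mem_replicate, List.mem_map] at ha
    rcases ha with (ha | ⟨-, rfl⟩ | rfl | ⟨b, -, rfl⟩) | ha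
    · exact (h.le a ha).trans (Nat.le_succ k)
    · simp
    · exact le_rfl
    · cases b <;> simp
    · exact hv a ha
  · intro c hc hce s hs
    exact hL (c, s) (List.pair_mem_product.2 ⟨List.mem_range.2 hc, List.mem_range.2 hs⟩) hc hce

theorem IsStage.of_continues {k : ℕ} {u w : List ℕ} (h : IsStage D k u)
    (hw : Continues D k u w) : IsStage D (k + 1) w := by
  obtain ⟨hpre, hle, ⟨_, hmem, rfl⟩, hcol⟩ := hw
  obtain ⟨t, rfl⟩ : ∃ t, w = u ++ t := ⟨w.drop u.length, by
    conv_lhs => rw [← List.take_append_drop u.length w, hpre]⟩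
  have hmem' : k + 1 ∈ t := by
    rcases List.mem_append.1 hmem with h' | h'
    · exact absurd (h.le _ h') (by omega)
    · exact h'
  refine ⟨hle, fun j hj => ?_, fun i hi j hj => ?_, ?_, fun c hc hj => ?_⟩
  · rcases Nat.le_succ_iff.1 hj with hj | rfl
    · exact List.mem_append_left _ (h.mem j hj)
    · exact hmem
  · by_cases hiu : i < u.length
    · rw [List.getElem_append_left hiu] at hj
      rw [List.take_append_of_le_length hiu.le]
      exact h.ordered i hiu j hj
    -- Past `u` the order is automatic: all blocks up to `k` already occur in `u`.
    · have := hle _ (List.getElem_mem hi)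
      rw [List.take_append]
      refine List.mem_append_left _ ?_
      rw [List.take_of_length_le (by omega)]
      exact h.mem j (by omega)
  · have := h.length
    have := List.length_pos_of_mem hmem'
    rw [List.length_append]
    omega
  · set c' := Nat.ofBits (n := k + 2) fun i => c i with hc'
    have hbit : ∀ j ≤ k + 1, c'.testBit j = c j := fun j hj => by
      rw [hc', Nat.testBit_ofBits_lt _ _ (show j < k + 2 by omega)]
    obtain ⟨j, hj, hcj⟩ := hj
    have := hcol c' (Nat.ofBits_lt_two_pow _) ⟨?_, ?_⟩ 0 (Nat.succ_pos k)
    · rwa [List.map_congr_left fun a ha => hbit a (hle a ha)] at this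
    · have := hbit 0 (Nat.zero_le _)
      rw [hc, Nat.testBit_zero] at this
      have := of_decide_eq_false this
      omega
    · intro h0
      have := hbit j hj
      rw [h0, Nat.zero_testBit, hcj] at this
      exact absurd this (by simp)

/-- If the sets `D s` of strings are decidable in `O` and closed under extension, strings in `D 0`
with arbitrarily long initial blocks exist, and every `D s` is dense above `D 0`, then some infinite
partition computable in `O` has all its `2`-coarsenings meet all `D s`. -/
theorem exists_partition_forall_coarsening
    (mono : ∀ s σ τ, D s σ → D s (σ ++ τ))
    (cofinal : ∀ N, ∃ m ≥ N, ∃ τ, D 0 (List.replicate m false ++ true :: τ))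
    (dense : ∀ σ, D 0 σ → ∀ s, ∃ τ, D s (σ ++ τ))
    (hD : DecidableIn O fun x : ℕ × List Bool => D x.1 x.2) :
    ∃ x : Partition ⊤, ComputableIn O x.1 ∧
      ∀ q ∈ coarsenings x 2, ∀ s, ∃ l, D s (initSeg q.1 l) := by
  have hof : Primrec (Denumerable.ofNat (List ℕ)) := Primrec.ofNat _
  have hQ : DecidableIn O fun x : (ℕ × ℕ) × ℕ =>
      Continues D x.1.1 (Denumerable.ofNat (List ℕ) x.1.2) (Denumerable.ofNat (List ℕ) x.2) :=
    (decidableIn_continues hD).comp (g := fun x : (ℕ × ℕ) × ℕ =>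
      ((x.1.1, Denumerable.ofNat (List ℕ) x.1.2), Denumerable.ofNat (List ℕ) x.2))
      (Primrec.pair (Primrec.pair (Primrec.fst.comp Primrec.fst)
        (hof.comp (Primrec.snd.comp Primrec.fst))) (hof.comp Primrec.snd)).computableIn
  -- The initial stage `[0]` has no admissible colouring, so it owes nothing to `D 0`.
  obtain ⟨f, hf, -, hstep⟩ := exists_computableIn_seq hQ
    (fun k y => IsStage D k (Denumerable.ofNat (List ℕ) y)) (y₀ := Encodable.encode [0])
    (by
      rw [Denumerable.ofNat_encode]
      refine ⟨by simp, by simp, fun i hi j hj => ?_, by simp, fun c hc => ?_⟩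
      · obtain rfl : i = 0 := by simpa using hi
        simp at hj
      · rintro ⟨j, hj, hcj⟩
        rw [Nat.le_zero.1 hj, hc] at hcj
        exact absurd hcj (by simp))
    (fun k y h => by
      obtain ⟨w, hw⟩ := h.exists_continues mono cofinal dense
      exact ⟨Encodable.encode w, by rwa [Denumerable.ofNat_encode]⟩)
    (fun k y w h hw => h.of_continues hw)
  obtain ⟨U, hU⟩ : ∃ U : ℕ → List ℕ, U = fun k => Denumerable.ofNat (List ℕ) (f k) := ⟨_, rfl⟩
  have hUc : ComputableIn O U := hU ▸ hof.computableIn.comp hf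
  have hst : ∀ k, IsStage D k (U k) := fun k => hU ▸ (hstep k).1
  have hcont : ∀ k, Continues D k (U k) (U (k + 1)) := fun k => hU ▸ (hstep k).2
  have hpre : ∀ k l, k ≤ l → U k <+: U l := fun k l h => by
    induction l, h using Nat.le_induction with
    | base => exact List.prefix_rfl
    | succ l _ ih => exact ih.trans (List.prefix_iff_eq_take.2 (hcont l).1.symm)
  -- Stage `i` has length greater than `i`, so the default 0 is never used.
  obtain ⟨x, hx⟩ : ∃ x : ℕ → ℕ, x = fun i => (U i).getD i 0 := ⟨_, rfl⟩
  have hget : ∀ k i (h : i < (U k).length), (U k)[i] = x i := by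
    intro k i h
    have hi := (hst i).length
    rw [hx]
    simp only [List.getD_eq_getElem?_getD, List.getElem?_eq_getElem hi, Option.getD_some]
    rcases le_total k i with hki | hki
    · exact (hpre _ _ hki).getElem h
    · exact ((hpre _ _ hki).getElem hi).symm
  have hmap : ∀ k (c : ℕ → Bool), (U k).map c = (List.range (U k).length).map fun i => c (x i) := by
    intro k c
    refine List.ext_getElem (by simp) fun i h₁ h₂ => ?_
    simp only [List.length_map] at h₁
    simp [hget k i h₁]
  have hsurj : ∀ j, ∃ i, x i = j := fun j => by
    obtain ⟨i, hi, h⟩ := List.mem_iff_getElem.1 ((hst j).mem j le_rfl)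
    exact ⟨i, by rw [← hget j i hi, h]⟩
  have hpart : IsPartition ⊤ x := by
    refine ⟨fun n => ENat.natCast_lt_top _, fun n j hj => ?_, fun i _ => hsurj i⟩
    have hn := (hst n).length
    rw [← hget n n hn] at hj
    obtain ⟨i, hi, h⟩ := List.mem_iff_getElem.1 ((hst n).ordered n hn j hj)
    rw [List.length_take] at hi
    rw [List.getElem_take, hget] at h
    exact ⟨i, by omega, h⟩
  refine ⟨⟨x, hpart⟩, ?_, fun q hq s => ?_⟩
  · change ComputableIn O x
    rw [hx]
    exact ((Primrec.list_getD 0).computableIn₂ (O := O)).comp (hUc.pair ComputableIn.id)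
  -- Choosing representatives turns the coarsening `q` into a colouring of the blocks of `x`.
  · choose r hr using hsurj
    have hc : ∀ n, decide (q.1 (r (x n)) = 1) = decide (q.1 n = 1) := fun n => by
      rw [hq (r (x n)) n (hr _)]
    have hq0 : q.1 0 = 0 := by
      by_contra h0
      obtain ⟨m, hm, -⟩ := q.2.2.1 0 0 (Nat.pos_of_ne_zero h0)
      exact absurd hm (Nat.not_lt_zero m)
    have hx0 : x 0 = 0 := by
      by_contra h0
      obtain ⟨m, hm, -⟩ := hpart.2.1 0 0 (Nat.pos_of_ne_zero h0)
      exact absurd hm (Nat.not_lt_zero m)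
    obtain ⟨n, hn⟩ := q.2.2.2 1 (by norm_num)
    obtain ⟨c, hcdef⟩ : ∃ c : ℕ → Bool, c = fun j => decide (q.1 (r j) = 1) := ⟨_, rfl⟩
    -- Late enough that requirement `s` is active and a block coloured `true` is present, so the
    -- code of the colouring is nonzero.
    obtain ⟨k, hk⟩ : ∃ k, k = max s (x n) := ⟨_, rfl⟩
    obtain ⟨c', hc'⟩ : ∃ c', c' = Nat.ofBits (n := k + 2) fun i => c i := ⟨_, rfl⟩
    have hbit : ∀ j ≤ k + 1, c'.testBit j = c j := fun j hj => by
      rw [hc', Nat.testBit_ofBits_lt _ _ (show j < k + 2 by omega)]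
    refine ⟨(U (k + 1)).length, ?_⟩
    have := (hcont k).2.2.2 c' (hc' ▸ Nat.ofBits_lt_two_pow _) ⟨?_, ?_⟩ s (by omega)
    · rw [List.map_congr_left fun a ha => hbit a ((hst (k + 1)).le a ha), hmap, hcdef] at this
      simpa only [hc, initSeg] using this
    · have h0 := hbit 0 (Nat.zero_le _)
      have : c 0 = false := by
        have := hc 0
        rw [hx0, hq0] at this
        rw [hcdef]
        exact this
      rw [this, Nat.testBit_zero] at h0
      have := of_decide_eq_false h0
      omega
    · intro h0
      have := hbit (x n) (by omega)
      rw [h0, Nat.zero_testBit, hcdef] at this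
      simp only [hc, hn] at this
      exact absurd this (by simp)

end Construction

end DualRamsey

/-! ### Forcing for Borel codes -/

namespace DualRamsey

/-- A number that identifies the shape of a label; strings that are not nodes are treated like nodes
labelled by the empty set. -/
def labelTag : Option Label → ℕ
  | some .union => 0
  | some .inter => 1
  | some .whole => 3
  | some (.cyl _) => 4
  | some (.compl _) => 5
  | _ => 2

/-- The string in a label. -/
def labelString : Option Label → List ℕ
  | some (.cyl ρ) => ρ
  | some (.compl ρ) => ρ
  | _ => []

theorem primrec_labelTag : Primrec labelTag := by
  have h : Primrec fun ℓ : Label => Sum.casesOn (motive := fun _ => ℕ) (Label.equivSum ℓ)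
      (fun x => Sum.casesOn (motive := fun _ => ℕ) x (fun b => cond b 0 1) fun b => cond b 3 2)
      (fun x => Sum.casesOn (motive := fun _ => ℕ) x (fun _ => 4) fun _ => 5) := by
    refine Primrec.sumCasesOn Primrec.of_equiv ?_ ?_
    · exact Primrec.sumCasesOn (f := fun x : Label × (Bool ⊕ Bool) => x.2) Primrec.snd
        ((Primrec.dom_bool fun b => cond b 0 1).comp Primrec.snd).to₂
        ((Primrec.dom_bool fun b => cond b 3 2).comp Primrec.snd).to₂
    · exact Primrec.sumCasesOn (f := fun x : Label × (List ℕ ⊕ List ℕ) => x.2) Primrec.snd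
        (Primrec.const 4) (Primrec.const 5)
  refine (Primrec.option_getD.comp (Primrec.option_map Primrec.id (h.comp Primrec.snd).to₂)
    (Primrec.const 2)).of_eq fun o => ?_
  rcases o with _ | _ | _ | _ | _ | _ | _ <;> rfl

theorem primrec_labelString : Primrec labelString := by
  have h : Primrec fun ℓ : Label => Sum.casesOn (motive := fun _ => List ℕ) (Label.equivSum ℓ)
      (fun _ => [])
      (fun x => Sum.casesOn (motive := fun _ => List ℕ) x (fun ρ => ρ) fun ρ => ρ) := by
    refine Primrec.sumCasesOn Primrec.of_equiv (Primrec.const []) ?_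
    exact Primrec.sumCasesOn (f := fun x : Label × (List ℕ ⊕ List ℕ) => x.2) Primrec.snd
        Primrec.snd Primrec.snd
  refine (Primrec.option_getD.comp (Primrec.option_map Primrec.id (h.comp Primrec.snd).to₂)
    (Primrec.const [])).of_eq fun o => ?_
  rcases o with _ | _ | _ | _ | _ | _ | _ <;> rfl

/-- The string `ρ` is an initial segment of the `0`-`1`-string that corresponds to `σ`. -/
def Agrees (ρ : List ℕ) (σ : List Bool) : Prop := (σ.map Bool.toNat).take ρ.length = ρ

/-- The string `σ` decides the clopen set named by a label: every element of `(ω)^2` extending `σ`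
is in the set if `s = true`, and none is if `s = false`. -/
def ForcesClopen (ℓ : Option Label) (σ : List Bool) (s : Bool) : Prop :=
  match ℓ with
  | some .whole => s = true
  | some (.cyl ρ) => ρ.length ≤ σ.length ∧ (Agrees ρ σ ↔ s = true)
  | some (.compl ρ) => ρ.length ≤ σ.length ∧ (Agrees ρ σ ↔ s = false)
  | _ => s = false

theorem Agrees.append_iff {ρ : List ℕ} {σ : List Bool} (h : ρ.length ≤ σ.length)
    (τ : List Bool) : Agrees ρ (σ ++ τ) ↔ Agrees ρ σ := by
  unfold Agrees
  rw [List.map_append, List.take_append_of_le_length (by simpa using h)]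

theorem ForcesClopen.append {ℓ : Option Label} {σ : List Bool} {s : Bool}
    (h : ForcesClopen ℓ σ s) (τ : List Bool) : ForcesClopen ℓ (σ ++ τ) s := by
  rcases ℓ with _ | _ | _ | _ | _ | ρ | ρ
  case some.cyl | some.compl =>
    obtain ⟨h₁, h₂⟩ := h
    exact ⟨by rw [List.length_append]; omega, (Agrees.append_iff h₁ τ).trans h₂⟩
  all_goals exact h

theorem exists_forcesClopen (ℓ : Option Label) (σ : List Bool) :
    ∃ τ s, ForcesClopen ℓ (σ ++ τ) s := by
  rcases ℓ with _ | _ | _ | _ | _ | ρ | ρ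
  case some.cyl | some.compl =>
    -- Padding makes the string at least as long as `ρ`, which settles agreement with it.
    refine ⟨List.replicate ρ.length false, ?_⟩
    by_cases h : Agrees ρ (σ ++ List.replicate ρ.length false)
    · first
        | exact ⟨true, by simp, by simpa using h⟩
        | exact ⟨false, by simp, by simpa using h⟩
    · first
        | exact ⟨false, by simp, by simpa using h⟩
        | exact ⟨true, by simp, by simpa using h⟩
  case some.whole => exact ⟨[], true, rfl⟩
  all_goals exact ⟨[], false, rfl⟩

theorem primrecPred_forcesClopen :
    PrimrecPred fun x : Option Label × List Bool × Bool => ForcesClopen x.1 x.2.1 x.2.2 := by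
  have htag : ∀ i, PrimrecPred fun x : Option Label × List Bool × Bool => labelTag x.1 = i :=
    fun i => Primrec.eq.comp (primrec_labelTag.comp Primrec.fst) (Primrec.const i)
  have hs : PrimrecPred fun x : Option Label × List Bool × Bool => x.2.2 = true :=
    Primrec.eq.comp (Primrec.snd.comp Primrec.snd) (Primrec.const true)
  have hstr : Primrec fun x : Option Label × List Bool × Bool => labelString x.1 :=
    primrec_labelString.comp Primrec.fst
  have hσ : Primrec fun x : Option Label × List Bool × Bool => x.2.1 :=
    Primrec.fst.comp Primrec.snd
  have hle : PrimrecPred fun x : Option Label × List Bool × Bool =>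
      (labelString x.1).length ≤ x.2.1.length :=
    Primrec.nat_le.comp (Primrec.list_length.comp hstr) (Primrec.list_length.comp hσ)
  have hag : PrimrecPred fun x : Option Label × List Bool × Bool =>
      Agrees (labelString x.1) x.2.1 :=
    Primrec.eq.comp (Primrec.list_take.comp (Primrec.list_length.comp hstr)
      (Primrec.list_map hσ ((Primrec.dom_bool Bool.toNat).comp Primrec.snd))) hstr
  have hpos : PrimrecPred fun x : Option Label × List Bool × Bool =>
      (Agrees (labelString x.1) x.2.1 ∧ x.2.2 = true) ∨
        (¬ Agrees (labelString x.1) x.2.1 ∧ ¬ x.2.2 = true) :=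
    (hag.and hs).or (hag.not.and hs.not)
  refine (((htag 3).and hs).or <| (((htag 4).and (hle.and hpos)).or <|
    ((htag 5).and (hle.and hpos.not)).or <|
    (((htag 3).or <| (htag 4).or (htag 5)).not.and hs.not))).of_eq fun x => ?_
  obtain ⟨ℓ, σ, s⟩ := x
  rcases ℓ with _ | _ | _ | _ | _ | ρ | ρ <;> cases s <;>
    simp [ForcesClopen, labelTag, labelString]

theorem agrees_initSeg_iff {q : Partition 2} {ρ : List ℕ} {l : ℕ} (h : ρ.length ≤ l) :
    Agrees ρ (initSeg q.1 l) ↔ q ∈ cylinder 2 ρ := by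
  have hq : ∀ i, (decide (q.1 i = 1)).toNat = q.1 i := fun i => by
    have : q.1 i < 2 := by exact_mod_cast q.2.1 i
    by_cases h1 : q.1 i = 1
    · simp [h1]
    · simp [h1]; omega
  have hm : (initSeg q.1 l).map Bool.toNat = (List.range l).map q.1 := by
    rw [initSeg, List.map_map]
    exact List.map_congr_left fun i _ => hq i
  unfold Agrees
  rw [hm, ← List.map_take, List.take_range, Nat.min_eq_left h]
  constructor
  · intro e n hn
    have : ((List.range ρ.length).map q.1)[n]'(by simpa using hn) = ρ[n] := by
      simp only [e]
    simpa using this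
  · intro e
    refine List.ext_getElem (by simp) fun i h₁ h₂ => ?_
    simpa using e i h₂

theorem Clopen.mem_iff {q : Partition 2} {ℓ : Label} {B : Set (Partition 2)} (hB : Clopen 2 ℓ B)
    {l : ℕ} {s : Bool} (h : ForcesClopen (some ℓ) (initSeg q.1 l) s) : q ∈ B ↔ s = true := by
  cases hB with
  | empty => cases h; simp
  | whole => cases h; simp
  | cyl ρ _ =>
    obtain ⟨h₁, h₂⟩ := h
    rw [initSeg_length] at h₁
    rw [← agrees_initSeg_iff h₁, h₂]
  | compl ρ _ =>
    obtain ⟨h₁, h₂⟩ := h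
    rw [initSeg_length] at h₁
    rw [Set.mem_compl_iff, ← agrees_initSeg_iff h₁, h₂]
    simp

/-! ### The forcing relation, density of decisions, and truth -/

section Forcing

variable (T : LabelledTree)

/-- Some child of the node `ν` is related to `σ` and `d` by `F`. -/
def HasChild (F : List Bool → List ℕ → Bool → Prop) (σ : List Bool) (ν : List ℕ) (d : Bool) :
    Prop :=
  ∃ a, T (ν ++ [a]) ≠ none ∧ F σ (ν ++ [a]) d

/-- The clause of the forcing relation for unions (`d = true`) and intersections (`d = false`). -/
def ForcesStep (F : List Bool → List ℕ → Bool → Prop) (d : Bool) (σ : List Bool) (ν : List ℕ)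
    (s : Bool) : Prop :=
  (s = d ∧ HasChild T F σ ν d) ∨ (s ≠ d ∧ ¬ ∃ τ, HasChild T F (σ ++ τ) ν d)

/-- `Forces T α σ ν s`: the string `σ` forces membership (`s = true`) or non-membership
(`s = false`) in the set represented by the part of `T` above `ν`, where only `α` levels of the tree
are taken into account. -/
def Forces : ℕ → List Bool → List ℕ → Bool → Prop
  | 0, σ, ν, s => ForcesClopen (T ν) σ s
  | α + 1, σ, ν, s =>
    (T ν = some .union ∧ ForcesStep T (Forces α) true σ ν s) ∨
    (T ν = some .inter ∧ ForcesStep T (Forces α) false σ ν s) ∨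
    (T ν ≠ some .union ∧ T ν ≠ some .inter ∧ ForcesClopen (T ν) σ s)

variable {T}

theorem forces_succ_union {α : ℕ} {σ : List Bool} {ν : List ℕ} {s : Bool}
    (h : T ν = some .union) :
    Forces T (α + 1) σ ν s ↔ ForcesStep T (Forces T α) true σ ν s := by
  simp [Forces, h]

theorem forces_succ_inter {α : ℕ} {σ : List Bool} {ν : List ℕ} {s : Bool}
    (h : T ν = some .inter) :
    Forces T (α + 1) σ ν s ↔ ForcesStep T (Forces T α) false σ ν s := by
  simp [Forces, h]

theorem forces_iff_forcesClopen {α : ℕ} {σ : List Bool} {ν : List ℕ} {s : Bool}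
    (h₁ : T ν ≠ some .union) (h₂ : T ν ≠ some .inter) :
    Forces T α σ ν s ↔ ForcesClopen (T ν) σ s := by
  cases α <;> simp [Forces, h₁, h₂]

theorem ForcesStep.append {F : List Bool → List ℕ → Bool → Prop}
    (hF : ∀ σ ν s, F σ ν s → ∀ τ, F (σ ++ τ) ν s) {d : Bool} {σ : List Bool} {ν : List ℕ}
    {s : Bool} (h : ForcesStep T F d σ ν s) (τ : List Bool) : ForcesStep T F d (σ ++ τ) ν s := by
  rcases h with ⟨hs, a, ha, h⟩ | ⟨hs, h⟩
  · exact .inl ⟨hs, a, ha, hF _ _ _ h τ⟩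
  · refine .inr ⟨hs, ?_⟩
    rintro ⟨τ', h'⟩
    exact h ⟨τ ++ τ', by rwa [← List.append_assoc]⟩

theorem Forces.append {α : ℕ} {σ : List Bool} {ν : List ℕ} {s : Bool}
    (h : Forces T α σ ν s) (τ : List Bool) : Forces T α (σ ++ τ) ν s := by
  induction α generalizing σ ν s τ with
  | zero => exact ForcesClopen.append h τ
  | succ α ih =>
    have ih' : ∀ σ ν s, Forces T α σ ν s → ∀ τ, Forces T α (σ ++ τ) ν s := fun _ _ _ h τ => ih h τ
    rcases h with ⟨h, h'⟩ | ⟨h, h'⟩ | ⟨h₁, h₂, h'⟩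
    · exact .inl ⟨h, h'.append ih' τ⟩
    · exact .inr (.inl ⟨h, h'.append ih' τ⟩)
    · exact .inr (.inr ⟨h₁, h₂, h'.append τ⟩)

theorem Forces.initSeg_of_le {α : ℕ} {q : ℕ → ℕ} {ν : List ℕ} {s : Bool} {l m : ℕ}
    (h : Forces T α (initSeg q l) ν s) (hlm : l ≤ m) : Forces T α (initSeg q m) ν s := by
  obtain ⟨τ, hτ⟩ := DualRamsey.initSeg_of_le q hlm
  exact hτ ▸ h.append τ

/-- If no extension has a child with value `d`, then `σ` itself already forces the opposite value.
-/
theorem exists_forcesStep (F : List Bool → List ℕ → Bool → Prop) (d : Bool) (σ : List Bool)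
    (ν : List ℕ) : ∃ τ s, ForcesStep T F d (σ ++ τ) ν s := by
  by_cases h : ∃ τ, HasChild T F (σ ++ τ) ν d
  · obtain ⟨τ, h⟩ := h
    exact ⟨τ, d, .inl ⟨rfl, h⟩⟩
  · exact ⟨[], !d, .inr ⟨by simp, by rwa [List.append_nil]⟩⟩

theorem exists_forces (α : ℕ) (σ : List Bool) (ν : List ℕ) :
    ∃ τ s, Forces T α (σ ++ τ) ν s := by
  cases α with
  | zero => exact exists_forcesClopen _ _
  | succ α =>
    by_cases h₁ : T ν = some .union
    · simpa only [forces_succ_union h₁] using exists_forcesStep _ _ _ _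
    · by_cases h₂ : T ν = some .inter
      · simpa only [forces_succ_inter h₂] using exists_forcesStep _ _ _ _
      · simpa only [forces_iff_forcesClopen h₁ h₂] using exists_forcesClopen _ _

variable (T) in
/-- The string `σ` decides the node `ν` at all levels `α ≤ n`. -/
def DecidesUpTo (n : ℕ) (σ : List Bool) (ν : List ℕ) : Prop :=
  ∀ α ≤ n, ∃ s, Forces T α σ ν s

theorem DecidesUpTo.append {n : ℕ} {σ : List Bool} {ν : List ℕ} (h : DecidesUpTo T n σ ν)
    (τ : List Bool) : DecidesUpTo T n (σ ++ τ) ν := fun α hα =>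
  (h α hα).imp fun _ h' => h'.append τ

theorem exists_decidesUpTo (n : ℕ) (σ : List Bool) (ν : List ℕ) :
    ∃ τ, DecidesUpTo T n (σ ++ τ) ν := by
  induction n with
  | zero =>
    obtain ⟨τ, s, h⟩ := exists_forces (T := T) 0 σ ν
    exact ⟨τ, fun α hα => ⟨s, Nat.le_zero.1 hα ▸ h⟩⟩
  | succ n ih =>
    obtain ⟨τ, h⟩ := ih
    obtain ⟨τ', s, h'⟩ := exists_forces (T := T) (n + 1) (σ ++ τ) ν
    refine ⟨τ ++ τ', fun α hα => ?_⟩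
    rw [← List.append_assoc]
    rcases Nat.le_succ_iff.1 hα with hα | rfl
    · exact (h α hα).imp fun _ h => h.append τ'
    · exact ⟨s, h'⟩

/-- The negative clause needs genericity: if a child truly had value `d`, some longer initial
segment of `q` would decide it, necessarily as `d`, against the choice of the condition. -/
theorem ForcesStep.mem_child {q : Partition 2} {α : ℕ} {d : Bool} {ν : List ℕ} {l : ℕ} {s : Bool}
    {A : ℕ → Set (Partition 2)} (hdec : ∀ ν, ∃ l s, Forces T α (initSeg q.1 l) ν s)
    (hA : ∀ a, T (ν ++ [a]) ≠ none → ∀ l s, Forces T α (initSeg q.1 l) (ν ++ [a]) s →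
      (q ∈ A a ↔ s = true))
    (h : ForcesStep T (Forces T α) d (initSeg q.1 l) ν s) :
    (s = d ↔ ∃ a, T (ν ++ [a]) ≠ none ∧ (q ∈ A a ↔ d = true)) := by
  rcases h with ⟨hs, a, ha, h⟩ | ⟨hs, h⟩
  · exact ⟨fun _ => ⟨a, ha, hA a ha l d h⟩, fun _ => hs⟩
  · refine ⟨fun h' => absurd h' hs, ?_⟩
    rintro ⟨a, ha, haA⟩
    obtain ⟨l', s', h'⟩ := hdec (ν ++ [a])
    have hsd : s' = d := by
      have := (hA a ha l' s' h').symm.trans haA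
      revert this
      cases s' <;> cases d <;> simp
    subst hsd
    obtain ⟨τ, hτ⟩ := DualRamsey.initSeg_of_le q.1 (le_max_left l l')
    exact absurd ⟨τ, a, ha, hτ ▸ h'.initSeg_of_le (le_max_right l l')⟩ h

/-- What is forced is true of every `q` that decides all nodes at all lower levels. -/
theorem BorelCode.mem_iff_of_forces {q : Partition 2} {α : ℕ}
    (hdec : ∀ β < α, ∀ ν, ∃ l s, Forces T β (initSeg q.1 l) ν s) {ν : List ℕ} {Γ : Kind} {β : ℕ}
    {T' : LabelledTree} {A : Set (Partition 2)} (hT' : ∀ σ, T' σ = T (ν ++ σ)) (hβ : β ≤ α)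
    (hA : BorelCode 2 Γ β T' A) {l : ℕ} {s : Bool} (h : Forces T α (initSeg q.1 l) ν s) :
    q ∈ A ↔ s = true := by
  induction α generalizing ν Γ β T' A l s with
  | zero =>
    -- At level 0 only clopen codes remain, so the conventional value of `ForcesClopen` at union and
    -- intersection nodes is never consulted here.
    cases hA with
    | clopen Γ _ ℓ _ root clopen leaf =>
      rw [hT', List.append_nil] at root
      rw [Forces, root] at h
      exact clopen.mem_iff h
    | union β pos => omega
    | inter β pos => omega
  | succ α ih =>
    have hchild : ∀ (Γ : ℕ → Kind) (γ : ℕ → ℕ) (A : ℕ → Set (Partition 2)),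
        (∀ a, T' [a] ≠ none → γ a < β) →
        (∀ a, T' [a] ≠ none → BorelCode 2 (Γ a) (γ a) (T'.subtree a) (A a)) →
        ∀ a, T (ν ++ [a]) ≠ none → ∀ l s, Forces T α (initSeg q.1 l) (ν ++ [a]) s →
          (q ∈ A a ↔ s = true) := by
      intro Γ γ A lt code a ha l s h
      rw [← hT'] at ha
      refine ih (fun β hβ => hdec β (by omega)) (T' := T'.subtree a) (fun σ => ?_)
        (by have := lt a ha; omega) (code a ha) h
      rw [LabelledTree.subtree, hT', List.append_assoc, List.singleton_append]
    cases hA with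
    | clopen Γ _ ℓ _ root clopen leaf =>
      rw [hT', List.append_nil] at root
      have h₁ : ℓ ≠ .union := by rintro rfl; cases clopen
      have h₂ : ℓ ≠ .inter := by rintro rfl; cases clopen
      rw [forces_iff_forcesClopen (by simp [root, h₁]) (by simp [root, h₂]), root] at h
      exact clopen.mem_iff h
    | union β pos _ root tree Γ γ A lt code =>
      rw [hT', List.append_nil] at root
      rw [forces_succ_union root] at h
      rw [h.mem_child (hdec α (Nat.lt_succ_self α)) (hchild Γ γ A lt code)]
      simp [hT']
    | inter β pos _ root tree Γ γ A lt code =>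
      rw [hT', List.append_nil] at root
      rw [forces_succ_inter root] at h
      -- Membership in an intersection is the failure of the `d = false` statement that some child
      -- omits `q`.
      rw [← Bool.not_eq_false, h.mem_child (hdec α (Nat.lt_succ_self α)) (hchild Γ γ A lt code)]
      simp [hT']

end Forcing

/-! ### The complexity of forcing -/

section Complexity

variable {T : LabelledTree} {O : Set (ℕ →. ℕ)}

theorem decidableIn_node (hT : Computable T) : DecidableIn O fun ν => T ν ≠ none := by
  refine ⟨fun ν => (T ν).isSome, Primrec.option_isSome.computableIn.comp hT.computableIn,
    fun ν => ?_⟩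
  rw [Option.isSome_iff_ne_none]

theorem decidableIn_tag (hT : Computable T) (i : ℕ) : DecidableIn O fun ν => labelTag (T ν) = i :=
  (DecidableIn.of_primrecPred (Primrec.eq.comp primrec_labelTag (Primrec.const i))).comp
    hT.computableIn

theorem labelTag_eq_zero {ℓ : Option Label} : labelTag ℓ = 0 ↔ ℓ = some .union := by
  rcases ℓ with _ | _ | _ | _ | _ | _ | _ <;> simp [labelTag]

theorem labelTag_eq_one {ℓ : Option Label} : labelTag ℓ = 1 ↔ ℓ = some .inter := by
  rcases ℓ with _ | _ | _ | _ | _ | _ | _ <;> simp [labelTag]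

/-- One clause is existential over children, the other the negation of an existential over
extensions and children, so a single jump decides both. -/
theorem decidableIn_forcesStep {X : Set ℕ} (hT : Computable T)
    {F : List Bool → List ℕ → Bool → Prop}
    (hF : DecidableIn {charFun X} fun x : List Bool × List ℕ × Bool => F x.1 x.2.1 x.2.2)
    (d : Bool) :
    DecidableIn {charFun (jump X)} fun x : List Bool × List ℕ × Bool =>
      ForcesStep T F d x.1 x.2.1 x.2.2 := by
  have hin : DecidableIn {charFun X} fun x : (List Bool × List ℕ × Bool) × List Bool × ℕ =>
      T (x.1.2.1 ++ [x.2.2]) ≠ none ∧ F (x.1.1 ++ x.2.1) (x.1.2.1 ++ [x.2.2]) d := by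
    have hν : Primrec fun x : (List Bool × List ℕ × Bool) × List Bool × ℕ =>
        x.1.2.1 ++ [x.2.2] :=
      Primrec.list_concat.comp (Primrec.fst.comp (Primrec.snd.comp Primrec.fst))
        (Primrec.snd.comp Primrec.snd)
    have hσ : Primrec fun x : (List Bool × List ℕ × Bool) × List Bool × ℕ => x.1.1 ++ x.2.1 :=
      Primrec.list_append.comp (Primrec.fst.comp Primrec.fst) (Primrec.fst.comp Primrec.snd)
    exact ((decidableIn_node hT).comp hν.computableIn).and
      (hF.comp (hσ.pair (hν.pair (Primrec.const d))).computableIn)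
  have hin' : DecidableIn {charFun X} fun x : (List Bool × List ℕ × Bool) × ℕ =>
      T (x.1.2.1 ++ [x.2]) ≠ none ∧ F (x.1.1 ++ []) (x.1.2.1 ++ [x.2]) d :=
    hin.comp (g := fun x : (List Bool × List ℕ × Bool) × ℕ => (x.1, [], x.2))
      (Primrec.fst.pair ((Primrec.const []).pair Primrec.snd)).computableIn
  have hs : DecidableIn {charFun (jump X)} fun x : List Bool × List ℕ × Bool => x.2.2 = d :=
    .of_primrecPred (Primrec.eq.comp (Primrec.snd.comp Primrec.snd) (Primrec.const d))
  refine ((hs.and hin'.exists_jump).or (hs.not.and hin.exists_jump.not)).of_iff fun x => ?_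
  simp only [ForcesStep, HasChild, List.append_nil, Prod.exists, ne_eq]

/-- Forcing at level `α` is decidable in the `α`-th jump of the empty set. -/
theorem decidableIn_forces (hT : Computable T) (α : ℕ) :
    DecidableIn {charFun (emptyJump α)} fun x : List Bool × List ℕ × Bool =>
      Forces T α x.1 x.2.1 x.2.2 := by
  have hν : ∀ {O}, ComputableIn O fun x : List Bool × List ℕ × Bool => x.2.1 :=
    (Primrec.fst.comp Primrec.snd).computableIn
  have hclopen : ∀ {O}, DecidableIn O fun x : List Bool × List ℕ × Bool =>
      ForcesClopen (T x.2.1) x.1 x.2.2 :=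
    (DecidableIn.of_primrecPred primrecPred_forcesClopen).comp
      ((hT.computableIn.comp hν).pair (ComputableIn.fst.pair
        (ComputableIn.snd.comp ComputableIn.snd)))
  induction α with
  | zero => exact hclopen
  | succ α ih =>
    rw [emptyJump_succ]
    refine ((((decidableIn_tag hT 0).comp hν).and (decidableIn_forcesStep hT ih true)).or <|
      (((decidableIn_tag hT 1).comp hν).and (decidableIn_forcesStep hT ih false)).or <|
      ((decidableIn_tag hT 0).comp hν).not.and <|
      ((decidableIn_tag hT 1).comp hν).not.and hclopen).of_iff fun x => ?_
    simp only [labelTag_eq_zero, labelTag_eq_one, Forces, ne_eq]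

theorem decidableIn_decidesUpTo (hT : Computable T) (n : ℕ) :
    DecidableIn {charFun (emptyJump n)} fun x : List Bool × List ℕ => DecidesUpTo T n x.1 x.2 := by
  have h : ∀ α, DecidableIn {charFun (emptyJump α)} fun x : List Bool × List ℕ =>
      ∃ s, Forces T α x.1 x.2 s := fun α => by
    have : ∀ s, DecidableIn {charFun (emptyJump α)} fun x : List Bool × List ℕ =>
        Forces T α x.1 x.2 s := fun s =>
      (decidableIn_forces hT α).comp (g := fun x : List Bool × List ℕ => (x.1, x.2, s))
        (Primrec.fst.pair (Primrec.snd.pair (Primrec.const s))).computableIn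
    exact ((this false).or (this true)).of_iff fun x => by simp
  induction n with
  | zero => exact (h 0).of_iff fun x => by simp [DecidesUpTo]
  | succ n ih =>
    have ih' := ih.jump
    rw [← emptyJump_succ] at ih'
    refine (ih'.and (h (n + 1))).of_iff fun x => ?_
    unfold DecidesUpTo
    constructor
    · rintro ⟨h₁, h₂⟩ α hα
      rcases Nat.le_succ_iff.1 hα with hα | rfl
      · exact h₁ α hα
      · exact h₂
    · exact fun h => ⟨fun α hα => h α (by omega), h _ le_rfl⟩

end Complexity

end DualRamsey

/-! ### The dichotomy -/

namespace DualRamsey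

/-- The variant of `exists_partition_forall_coarsening` in which the strings that start the
construction and the requirements are given separately. -/
theorem exists_partition_of_dense {O : Set (ℕ →. ℕ)} {M : List Bool → Prop}
    {K : ℕ → List Bool → Prop} (hM : DecidableIn O M)
    (hK : DecidableIn O fun x : ℕ × List Bool => K x.1 x.2)
    (monoM : ∀ σ τ, M σ → M (σ ++ τ)) (monoK : ∀ s σ τ, K s σ → K s (σ ++ τ))
    (cofinal : ∀ N, ∃ m ≥ N, ∃ τ, M (List.replicate m false ++ true :: τ))
    (dense : ∀ σ, M σ → ∀ s, ∃ τ, K s (σ ++ τ)) :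
    ∃ x : Partition ⊤, ComputableIn O x.1 ∧ ∀ q ∈ coarsenings x 2,
      (∃ l, M (initSeg q.1 l)) ∧ ∀ s, ∃ l, K s (initSeg q.1 l) := by
  obtain ⟨x, hx, h⟩ := exists_partition_forall_coarsening (O := O)
    (D := fun s σ => (s = 0 ∧ M σ) ∨ (s ≠ 0 ∧ K (s - 1) σ))
    (fun s σ τ h => h.imp (And.imp_right (monoM σ τ)) (And.imp_right (monoK _ σ τ)))
    (fun N => by simpa using cofinal N)
    (fun σ hσ s => by
      replace hσ : M σ := by simpa using hσ
      rcases s with _ | s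
      · exact ⟨[], by simpa using hσ⟩
      · simpa using dense σ hσ s)
    (by
      have h0 : DecidableIn O fun x : ℕ × List Bool => x.1 = 0 :=
        .of_primrecPred (Primrec.eq.comp Primrec.fst (Primrec.const 0))
      exact (h0.and (hM.comp ComputableIn.snd)).or (h0.not.and
        (hK.comp (g := fun x : ℕ × List Bool => (x.1 - 1, x.2))
          ((Primrec.pred.comp Primrec.fst).pair Primrec.snd).computableIn)))
  refine ⟨x, hx, fun q hq => ⟨?_, fun s => ?_⟩⟩
  · simpa using h q hq 0
  · simpa using h q hq (s + 1)

variable {T : LabelledTree}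

theorem exists_decides_of_decidesUpTo {n : ℕ} {q : ℕ → ℕ}
    (h : ∀ s, ∃ l, DecidesUpTo T n (initSeg q l) (Denumerable.ofNat (List ℕ) s)) :
    ∀ β < n + 1, ∀ ν, ∃ l s, Forces T β (initSeg q l) ν s := by
  intro β hβ ν
  obtain ⟨l, hl⟩ := h (Encodable.encode ν)
  rw [Denumerable.ofNat_encode] at hl
  exact ⟨l, hl β (by omega)⟩

theorem decidableIn_decidesUpTo_ofNat (hT : Computable T) (n : ℕ) :
    DecidableIn {charFun (emptyJump n)} fun x : ℕ × List Bool =>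
      DecidesUpTo T n x.2 (Denumerable.ofNat (List ℕ) x.1) :=
  (decidableIn_decidesUpTo hT n).comp
    (g := fun x : ℕ × List Bool => (x.2, Denumerable.ofNat (List ℕ) x.1))
    (Primrec.snd.pair ((Primrec.ofNat _).comp Primrec.fst)).computableIn

/-- If conditions with arbitrarily late second block force some child of the root, then
a partition computable in the `(n + 1)`-st jump has every `2`-coarsening force one. -/
theorem exists_partition_forces (hT : Computable T) (n : ℕ)
    (h : ∀ N, ∃ m ≥ N, ∃ a, T [a] ≠ none ∧
      ∃ τ, Forces T (n + 1) (List.replicate m false ++ true :: τ) [a] true) :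
    ∃ x : Partition ⊤, ComputableFrom (emptyJump (n + 1)) x ∧ ∀ q ∈ coarsenings x 2,
      (∀ β < n + 1, ∀ ν, ∃ l s, Forces T β (initSeg q.1 l) ν s) ∧
      ∃ a, T [a] ≠ none ∧ ∃ l, Forces T (n + 1) (initSeg q.1 l) [a] true := by
  refine (exists_partition_of_dense (O := {charFun (emptyJump (n + 1))})
    -- The bound on `a` avoids an unbounded search; padding a condition by `a + 1` zeros achieves
    -- it.
    (M := fun σ => ∃ a < σ.length, T [a] ≠ none ∧ Forces T (n + 1) σ [a] true)
    (K := fun s σ => DecidesUpTo T n σ (Denumerable.ofNat (List ℕ) s)) ?_ ?_ ?_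
    (fun s σ τ h => h.append τ) ?_ (fun σ _ s => exists_decidesUpTo n σ _)).imp
      fun x hx => ⟨hx.1, fun q hq => ⟨exists_decides_of_decidesUpTo (hx.2 q hq).2, ?_⟩⟩
  · have ha : Primrec fun x : List Bool × ℕ => [x.2] :=
      Primrec.list_cons.comp Primrec.snd (Primrec.const [])
    have hF := (decidableIn_forces hT (n + 1)).comp
      (g := fun x : List Bool × ℕ => (x.1, [x.2], true))
      (Primrec.fst.pair (ha.pair (Primrec.const true))).computableIn
    exact (((decidableIn_node hT).comp ha.computableIn).and hF).exists_lt
      Primrec.list_length.computableIn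
  · rw [emptyJump_succ]
    exact (decidableIn_decidesUpTo_ofNat hT n).jump
  · rintro σ τ ⟨a, hl, ha, hF⟩
    exact ⟨a, by rw [List.length_append]; omega, ha, hF.append τ⟩
  · intro N
    obtain ⟨m, hm, a, ha, τ, hF⟩ := h N
    refine ⟨m, hm, τ ++ List.replicate (a + 1) false, a, ?_, ha, ?_⟩
    · simp only [List.length_append, List.length_cons, List.length_replicate]
      omega
    · simpa using hF.append (List.replicate (a + 1) false)
  · obtain ⟨l, a, -, ha, hl⟩ := (hx.2 q hq).1
    exact ⟨a, ha, l, hl⟩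

theorem exists_eq_replicate_append {σ : List Bool} (h : true ∈ σ) :
    ∃ τ, σ = List.replicate (σ.idxOf true) false ++ true :: τ := by
  induction σ with
  | nil => simp at h
  | cons b σ ih =>
    cases b with
    | true => exact ⟨σ, by simp⟩
    | false =>
      obtain ⟨τ, hτ⟩ := ih (by simpa using h)
      refine ⟨τ, ?_⟩
      rw [List.idxOf_cons_ne _ (by simp), List.replicate_succ, List.cons_append, ← hτ]

/-- If no condition with a late second block forces a child of the root, then a partition
computable in the `n`-th jump has every `2`-coarsening force all children to fail. -/
theorem exists_partition_forces_not (hT : Computable T) (n N : ℕ)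
    (h : ∀ m ≥ N, ∀ a, T [a] ≠ none →
      ∀ τ, ¬ Forces T (n + 1) (List.replicate m false ++ true :: τ) [a] true) :
    ∃ x : Partition ⊤, ComputableFrom (emptyJump n) x ∧ ∀ q ∈ coarsenings x 2,
      (∀ β < n + 1, ∀ ν, ∃ l s, Forces T β (initSeg q.1 l) ν s) ∧
      ∀ a, T [a] ≠ none → ∃ l, Forces T (n + 1) (initSeg q.1 l) [a] false := by
  have hM : ∀ σ : List Bool, N ≤ σ.idxOf true ∧ σ.idxOf true < σ.length → ∀ a, T [a] ≠ none →
      ∀ τ, ¬ Forces T (n + 1) (σ ++ τ) [a] true := by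
    rintro σ ⟨hN, hlt⟩ a ha τ hF
    obtain ⟨ρ, hρ⟩ := exists_eq_replicate_append (List.idxOf_lt_length_iff.1 hlt)
    rw [hρ, List.append_assoc, List.cons_append] at hF
    exact h _ hN a ha _ hF
  refine (exists_partition_of_dense (O := {charFun (emptyJump n)})
    -- `idxOf` returns the length when `true` is absent, so the second conjunct says that block 1
    -- has started.
    (M := fun σ => N ≤ σ.idxOf true ∧ σ.idxOf true < σ.length)
    -- Only forcing at levels up to `n` occurs here, which keeps the construction computable in the
    -- `n`-th jump.
    (K := fun s σ => DecidesUpTo T n σ (Denumerable.ofNat (List ℕ) s) ∧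
      (labelTag (T [s]) = 1 → ∃ b < σ.length, T [s, b] ≠ none ∧ Forces T n σ [s, b] false))
    ?_ ?_ ?_ ?_ ?_ ?_).imp fun x hx => ⟨hx.1, fun q hq => ?_⟩
  · have hi : Primrec fun σ : List Bool => σ.idxOf true :=
      Primrec.list_idxOf.comp (Primrec.const true) Primrec.id
    exact .of_primrecPred ((Primrec.nat_le.comp (Primrec.const N) hi).and
      (Primrec.nat_lt.comp hi Primrec.list_length))
  · have h₁ : Primrec fun x : ℕ × List Bool => [x.1] :=
      Primrec.list_cons.comp Primrec.fst (Primrec.const [])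
    have h₂ : Primrec fun x : (ℕ × List Bool) × ℕ => [x.1.1, x.2] :=
      Primrec.list_cons.comp (Primrec.fst.comp Primrec.fst)
        (Primrec.list_cons.comp Primrec.snd (Primrec.const []))
    have hF := (decidableIn_forces hT n).comp
      (g := fun x : (ℕ × List Bool) × ℕ => (x.1.2, [x.1.1, x.2], false))
      ((Primrec.snd.comp Primrec.fst).pair (h₂.pair (Primrec.const false))).computableIn
    exact (decidableIn_decidesUpTo_ofNat hT n).and
      (((decidableIn_tag hT 1).comp h₁.computableIn).imp
        ((((decidableIn_node hT).comp h₂.computableIn).and hF).exists_lt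
          (Primrec.list_length.comp Primrec.snd).computableIn))
  · rintro σ τ ⟨hN, hlt⟩
    rw [List.idxOf_append_of_mem (List.idxOf_lt_length_iff.1 hlt), List.length_append]
    exact ⟨hN, by omega⟩
  · rintro s σ τ ⟨hd, hc⟩
    refine ⟨hd.append τ, fun ht => ?_⟩
    obtain ⟨b, hlt, hb, hF⟩ := hc ht
    exact ⟨b, by rw [List.length_append]; omega, hb, hF.append τ⟩
  · intro m
    refine ⟨max m N, le_max_left _ _, [], ?_⟩
    have : (List.replicate (max m N) false ++ [true]).idxOf true = max m N := by
      rw [List.idxOf_append_of_notMem (by simp)]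
      simp
    rw [this]
    simp
  · intro σ hσ s
    obtain ⟨τ, hτ⟩ := exists_decidesUpTo (T := T) n σ (Denumerable.ofNat (List ℕ) s)
    by_cases ht : T [s] = some .inter
    · have hnot := hM σ hσ s (by simp [ht]) τ
      rw [forces_succ_inter ht] at hnot
      -- If no extension forced a grandchild false, the intersection `[s]` would be forced true,
      -- which is excluded past `N`.
      obtain ⟨τ', b, hb, hF⟩ : ∃ τ', HasChild T (Forces T n) (σ ++ τ ++ τ') [s] false := by
        by_contra hc
        exact hnot (.inr ⟨by simp, hc⟩)
      refine ⟨τ ++ τ' ++ List.replicate (b + 1) false, ?_, fun _ => ⟨b, ?_, hb, ?_⟩⟩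
      · simpa using hτ.append (τ' ++ List.replicate (b + 1) false)
      · simp only [List.length_append, List.length_replicate]
        omega
      · simpa using hF.append (List.replicate (b + 1) false)
    · exact ⟨τ, hτ, fun h1 => absurd (labelTag_eq_one.1 h1) ht⟩
  · have hdec := exists_decides_of_decidesUpTo fun s => ((hx.2 q hq).2 s).imp fun _ => And.left
    refine ⟨hdec, fun a ha => ?_⟩
    obtain ⟨l, hl⟩ := (hx.2 q hq).1
    have hnot := hM _ hl a ha
    by_cases h₁ : T [a] = some .union
    -- For a union child, never being forced true is the same as being forced false.
    · refine ⟨l, (forces_succ_union h₁).2 (.inr ⟨by simp, ?_⟩)⟩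
      rintro ⟨τ, hτ⟩
      exact hnot τ ((forces_succ_union h₁).2 (.inl ⟨rfl, hτ⟩))
    · by_cases h₂ : T [a] = some .inter
      · obtain ⟨l', -, hl'⟩ := (hx.2 q hq).2 a
        obtain ⟨b, -, hb⟩ := hl' (labelTag_eq_one.2 h₂)
        exact ⟨l', (forces_succ_inter h₂).2 (.inl ⟨rfl, b, hb⟩)⟩
      -- A clopen child is decided at level 0, and the value `true` would contradict the choice of
      -- `N` on a common extension.
      · obtain ⟨l', s, hs⟩ := hdec 0 (Nat.succ_pos n) [a]
        have hs' : Forces T (n + 1) (initSeg q.1 l') [a] s :=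
          (forces_iff_forcesClopen h₁ h₂).2 hs
        cases s with
        | false => exact ⟨l', hs'⟩
        | true =>
          obtain ⟨τ, hτ⟩ := initSeg_of_le q.1 (le_max_left l l')
          exact absurd (hτ ▸ hs'.initSeg_of_le (le_max_right l l')) (hnot τ)

end DualRamsey

theorem mainTheorem6 (n : ℕ) (T : DualRamsey.LabelledTree) (hT : Computable T)
    (R : Set (DualRamsey.Partition 2))
    (hR : DualRamsey.BorelCode 2 DualRamsey.Kind.sigma (n + 2) T R) :
    (∃ x : DualRamsey.Partition ⊤, DualRamsey.ComputableFrom (DualRamsey.emptyJump n) x ∧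
        DualRamsey.coarsenings x 2 ⊆ Rᶜ) ∨
      (∃ x : DualRamsey.Partition ⊤, DualRamsey.ComputableFrom (DualRamsey.emptyJump (n + 1)) x ∧
        DualRamsey.coarsenings x 2 ⊆ R) := by
  cases hR with
  | union _ pos _ root tree Γ β A lt code =>
    -- Children of the root have level at most `n + 1`, so forcing at that level covers them all.
    by_cases h : ∃ N, ∀ m ≥ N, ∀ a, T [a] ≠ none →
        ∀ τ, ¬ DualRamsey.Forces T (n + 1) (List.replicate m false ++ true :: τ) [a] true
    · obtain ⟨N, hN⟩ := h
      obtain ⟨x, hx, hq⟩ := DualRamsey.exists_partition_forces_not hT n N hN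
      refine .inl ⟨x, hx, fun q hqx => ?_⟩
      rintro ⟨a, ha, hqa⟩
      obtain ⟨l, hl⟩ := (hq q hqx).2 a ha
      exact absurd (((code a ha).mem_iff_of_forces (hq q hqx).1 (fun _ => rfl)
        (Nat.lt_succ_iff.1 (lt a ha)) hl).1 hqa) (by simp)
    · push Not at h
      obtain ⟨x, hx, hq⟩ := DualRamsey.exists_partition_forces hT n h
      refine .inr ⟨x, hx, fun q hqx => ?_⟩
      obtain ⟨hdec, a, ha, l, hl⟩ := hq q hqx
      exact ⟨a, ha, ((code a ha).mem_iff_of_forces hdec (fun _ => rfl)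
        (Nat.lt_succ_iff.1 (lt a ha)) hl).2 rfl⟩
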